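/- For $n\in\mathbb N$ and a permutation $\sigma$ of $[n]=\{1,\dots,n\}$ let $P_\sigma$ be the $n\times n$ permutation matrix with $P_\sigma(i,j)=1$ if $\sigma(i)=j$ and $0$ otherwise, and let $P^{[2]}_\sigma=yy^{T}\in\mathbb R^{n^2\times n^2}$ with $y=\mathrm{vec}(P_\sigma)$, i.e. $P^{[2]}_\sigma(ij,kl)=P_\sigma(i,j)P_\sigma(k,l)$. The QAP-polytope is $\mathrm{QAP}_n=\mathrm{conv}\{P^{[2]}_\sigma:\sigma\in S_n\}$. A bounded relaxation of $\mathrm{QAP}_n$ is a polytope (a bounded solution set of finitely many linear inequalities) $R\subset\mathbb R^{n^2\times n^2}$ with $\mathrm{QAP}_n\subseteq R$. An extended formulation of a polytope $P\subset\mathbb R^d$ is a polytope $Q\subset\mathbb R^{d+r}$, for some $r\ge 0$, with $P=\{x\in\mathbb R^d:\exists y\in\mathbb R^r,\ (x,y)\in Q\}$. The extension complexity $\mathrm{xc}(P)$ is the minimum number of facets of an extended formulation of $P$. The QAP3 inequalities are the inequalities $$-(\beta-1)\sum_{(i,j)\in P_1\times Q}Y_{ij,ij}+\beta\sum_{(i,j)\in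 P_2\times Q}Y_{ij,ij}+\sum_{\substack{(i,j),(k,l)\in P_1\times Q\\ i<k}}Y_{ij,kl}+\sum_{\substack{(i,j),(k,l)\in P_2\times Q\\ i<k}}Y_{ij,kl}-\sum_{\substack{(i,j)\in P_1\times Q\\ (k,l)\in P_2\times Q}}Y_{ij,kl}\ \ge\ \frac{\beta-\beta^2}{2}$$ for all $\beta\in\mathbb Z$ and $P_1,P_2,Q\subseteq[n]$ with $P_1\cap P_2=\emptyset$ such that (i) $3\le|Q|\le n-3$; (ii) $|P_1|+|P_2|\le n-3$; (iii) $|P_1|\ge\min\{2,\beta+1\}$; (iv) $|P_2|\ge\min\{1,-\beta+2\}$; (v) $\bigl||P_1|-|P_2|-\beta\bigr|\le n-|Q|-4$; (vi) if $|P_2|=1$, then $|Q|\ge\min\{-\beta+5,\beta+2\}$; if $|P_2|\ge 2$, then $|Q|\ge\min\{-\beta+5,\beta+3\}$ or $|Q|\ge\min\{-\beta+4,\beta+4\}$. **Theorem.** Every bounded relaxation $R$ of $\mathrm{QAP}_n$ for which all QAP3 inequalities are valid satisfies $\mathrm{xc}(R)\ge 2^{\Omega(n)}$. That is, there are constants $c>0$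 and $N\in\mathbb N$ such that for all $n\ge N$ and every bounded relaxation $R$ of $\mathrm{QAP}_n$ for which all QAP3 inequalities are valid, $\mathrm{xc}(R)\ge 2^{cn}$. -/

import Mathlib

noncomputable section

/-- A bounded solution set of finitely many linear inequalities. -/
def IsPolytope {V : Type*} [NormedAddCommGroup V] [NormedSpace ℝ V] (S : Set V) : Prop :=
  (∃ (m : ℕ) (A : Fin m → StrongDual ℝ V) (b : Fin m → ℝ), S = {x | ∀ i, A i x ≤ b i}) ∧
    Bornology.IsBounded S

/-- `F` is a facet of `S`: a nonempty face (the set of maximizers over `S` of a linear functional)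
whose affine dimension is one less than that of `S`. -/
def IsFacet {V : Type*} [NormedAddCommGroup V] [NormedSpace ℝ V] (S F : Set V) : Prop :=
  IsExposed ℝ S F ∧ F.Nonempty ∧
    Module.finrank ℝ (vectorSpan ℝ F) + 1 = Module.finrank ℝ (vectorSpan ℝ S)

/-- The size of a polytope: its number of facets. -/
def polytopeSize {V : Type*} [NormedAddCommGroup V] [NormedSpace ℝ V] (S : Set V) : ℕ :=
  {F : Set V | IsFacet S F}.ncard

/-- `Q` is an extended formulation of `P`: a polytope, in a space with `r` further coordinates,
whose projection that forgets these coordinates is `P`. -/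
def IsExtendedFormulation {V : Type*} [NormedAddCommGroup V] [NormedSpace ℝ V] {r : ℕ}
    (Q : Set (V × (Fin r → ℝ))) (P : Set V) : Prop :=
  IsPolytope Q ∧ P = {x | ∃ y : Fin r → ℝ, (x, y) ∈ Q}

/-- The extension complexity of a polytope: the least size of an extended formulation of it. -/
def extensionComplexity {V : Type*} [NormedAddCommGroup V] [NormedSpace ℝ V] (P : Set V) : ℕ :=
  sInf {k : ℕ | ∃ (r : ℕ) (Q : Set (V × (Fin r → ℝ))),
    IsExtendedFormulation Q P ∧ polytopeSize Q = k}

/-- The space of real `n² × n²` matrices `Y`, with entries `Y (i, j) (k, l)`. -/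
abbrev QAPSpace (n : ℕ) : Type := Fin n × Fin n → Fin n × Fin n → ℝ

/-- The vertex `y yᵀ` for `y = vec (P_σ)`, where `P_σ (i, j) = 1` if `σ i = j`, and `0` otherwise. -/
def qapVertex {n : ℕ} (σ : Equiv.Perm (Fin n)) : QAPSpace n :=
  fun p q => σ.permMatrix ℝ p.1 p.2 * σ.permMatrix ℝ q.1 q.2

/-- The QAP-polytope. -/
def qapPolytope (n : ℕ) : Set (QAPSpace n) :=
  convexHull ℝ (Set.range (qapVertex (n := n)))

/-- The conditions on the parameters of the family QAP3. -/
structure IsQAP3Param (n : ℕ) (P₁ P₂ Q : Finset (Fin n)) (β : ℤ) : Prop where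
  disjoint : Disjoint P₁ P₂
  three_le_card_Q : 3 ≤ (Q.card : ℤ)
  card_Q_le : (Q.card : ℤ) ≤ (n : ℤ) - 3
  card_add_le : (P₁.card : ℤ) + P₂.card ≤ (n : ℤ) - 3
  card_P₁ : min 2 (β + 1) ≤ (P₁.card : ℤ)
  card_P₂ : min 1 (-β + 2) ≤ (P₂.card : ℤ)
  abs_le : |(P₁.card : ℤ) - P₂.card - β| ≤ (n : ℤ) - Q.card - 4
  of_card_eq_one : P₂.card = 1 → min (-β + 5) (β + 2) ≤ (Q.card : ℤ)
  of_two_le_card : 2 ≤ P₂.card →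
    min (-β + 5) (β + 3) ≤ (Q.card : ℤ) ∨ min (-β + 4) (β + 4) ≤ (Q.card : ℤ)

/-- The left-hand side of the QAP3 inequality `qap3Lhs P₁ P₂ Q β Y ≥ (β - β²) / 2`. -/
def qap3Lhs {n : ℕ} (P₁ P₂ Q : Finset (Fin n)) (β : ℤ) (Y : QAPSpace n) : ℝ :=
  -((β : ℝ) - 1) * (∑ p ∈ P₁ ×ˢ Q, Y p p)
    + (β : ℝ) * (∑ p ∈ P₂ ×ˢ Q, Y p p)
    + (∑ p ∈ P₁ ×ˢ Q, ∑ q ∈ P₁ ×ˢ Q with p.1 < q.1, Y p q)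
    + (∑ p ∈ P₂ ×ˢ Q, ∑ q ∈ P₂ ×ˢ Q with p.1 < q.1, Y p q)
    - (∑ p ∈ P₁ ×ˢ Q, ∑ q ∈ P₂ ×ˢ Q, Y p q)

/-- All inequalities of the family QAP3 are valid for the set `R`. -/
def QAP3Valid {n : ℕ} (R : Set (QAPSpace n)) : Prop :=
  ∀ (P₁ P₂ Q : Finset (Fin n)) (β : ℤ), IsQAP3Param n P₁ P₂ Q β →
    ∀ Y ∈ R, ((β : ℝ) - (β : ℝ) ^ 2) / 2 ≤ qap3Lhs P₁ P₂ Q β Y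

/-- `R` is a bounded relaxation of the QAP-polytope: a polytope that contains it. -/
def IsBoundedQAPRelaxation {n : ℕ} (R : Set (QAPSpace n)) : Prop :=
  IsPolytope R ∧ qapPolytope n ⊆ R

end

/-! Take β = 2 and P₂ = ∅. At the vertex of σ, with t the number of i ∈ P₁ such that σ(i) ∈ Q, the
slack is 1 - t + t(t-1)/2, which is 1 for t = 0 and 0 for t = 1. `exists_unique_disjointness_slack`
fixes Q and attaches to subsets A, B of an m-set, m about n/2, a set P₁ and a permutation with t =
|A ∩ B|: this is a unique disjointness pattern.

A facet F of an extended formulation gives a rectangle: the A whose tight face lies in F, times the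
B whose lifted vertex lies outside F. It contains no pair with |A ∩ B| = 1. By
`IsPolytope.exists_isFacet` these rectangles, with one extra for inequalities that are nowhere
tight, cover all 3^m disjoint pairs. Each contains at most 2^m of them
(`sum_disjoint_pairs_rectangle_le`), so there are at least (3/2)^m rectangles. -/

/-! ### Rectangle coverings of unique disjointness -/

open Finset in
/-- Summing over pairs of subsets of `insert e U` splits according to membership of `e`. -/
theorem sum_powerset_insert_sum_powerset_insert {α : Type*} [DecidableEq α] {e : α}
    {U : Finset α} (he : e ∉ U) (f : Finset α → Finset α → ℕ) :
    ∑ A ∈ (insert e U).powerset, ∑ B ∈ (insert e U).powerset, f A B =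
      ∑ A ∈ U.powerset, ∑ B ∈ U.powerset,
        (f A B + f A (insert e B) + f (insert e A) B + f (insert e A) (insert e B)) := by
  simp only [sum_powerset_insert he, sum_add_distrib]
  ring

open Finset in
/-- A finite set `U` has `3 ^ #U` pairs of disjoint subsets. -/
theorem sum_disjoint_pairs {α : Type*} [DecidableEq α] (U : Finset α) :
    ∑ A ∈ U.powerset, ∑ B ∈ U.powerset, (if Disjoint A B then 1 else 0) = 3 ^ #U := by
  induction U using Finset.induction_on with
  | empty => simp
  | insert e U he ih =>
    rw [sum_powerset_insert_sum_powerset_insert he, card_insert_of_notMem he, pow_succ, ← ih,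
      sum_mul]
    refine sum_congr rfl fun A hA => ?_
    rw [sum_mul]
    refine sum_congr rfl fun B hB => ?_
    have hA' : e ∉ A := fun h => he (mem_powerset.1 hA h)
    have hB' : e ∉ B := fun h => he (mem_powerset.1 hB h)
    by_cases h : Disjoint A B <;>
      simp [h, hA', hB', disjoint_insert_left, disjoint_insert_right]

open Finset Classical in
/-- A rectangle of pairs of subsets of `U` that never meet in exactly one element contains at most
`2 ^ #U` disjoint pairs. -/
theorem sum_disjoint_pairs_rectangle_le {α : Type*} [DecidableEq α] (U : Finset α) :
    ∀ 𝒜 ℬ : Set (Finset α),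
      (∀ A ∈ 𝒜, ∀ B ∈ ℬ, A ⊆ U → B ⊆ U → #(A ∩ B) ≠ 1) →
      ∑ A ∈ U.powerset, ∑ B ∈ U.powerset, (if A ∈ 𝒜 ∧ B ∈ ℬ ∧ Disjoint A B then 1 else 0)
        ≤ 2 ^ #U := by
  induction U using Finset.induction_on with
  | empty =>
    intro 𝒜 ℬ _
    simp only [powerset_empty, sum_singleton, card_empty, pow_zero]
    split_ifs <;> simp
  | insert e U he ih =>
    intro 𝒜 ℬ h
    have hsub : ∀ {A : Finset α}, A ⊆ U → A ⊆ insert e U := fun hA =>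
      hA.trans (subset_insert _ _)
    have hins : ∀ {A : Finset α}, A ⊆ U → insert e A ⊆ insert e U := fun hA =>
      insert_subset_insert _ hA
    -- Two rectangles over `U` account for the three disjoint extensions of a disjoint pair: `e` in
    -- neither set, in B only, in A only. The extensions A ∪ {e} and B ∪ {e} meet exactly in `e`, so
    -- they cannot both be admitted; hence two rectangles suffice and the bound only doubles.
    have h1 := ih {A | A ∈ 𝒜 ∨ insert e A ∈ 𝒜} ℬ (by
      rintro A (hA | hA) B hB hAU hBU
      · exact h A hA B hB (hsub hAU) (hsub hBU)
      · have := h _ hA B hB (hins hAU) (hsub hBU)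
        rwa [insert_inter_of_notMem fun hh => he (hBU hh)] at this)
    have h2 := ih 𝒜 {B | B ∈ ℬ ∨ insert e B ∈ ℬ} (by
      rintro A hA B (hB | hB) hAU hBU
      · exact h A hA B hB (hsub hAU) (hsub hBU)
      · have := h A hA _ hB (hsub hAU) (hins hBU)
        rwa [inter_insert_of_notMem fun hh => he (hAU hh)] at this)
    rw [sum_powerset_insert_sum_powerset_insert he, card_insert_of_notMem he, pow_succ, mul_two]
    refine le_trans ?_ (add_le_add h1 h2)
    rw [← sum_add_distrib]
    refine sum_le_sum fun A hA => ?_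
    rw [← sum_add_distrib]
    refine sum_le_sum fun B hB => ?_
    rw [mem_powerset] at hA hB
    have hA' : e ∉ A := fun h => he (hA h)
    have hB' : e ∉ B := fun h => he (hB h)
    by_cases hd : Disjoint A B
    · have h3 : ¬ (insert e A ∈ 𝒜 ∧ insert e B ∈ ℬ) := by
        rintro ⟨h4, h5⟩
        apply h _ h4 _ h5 (hins hA) (hins hB)
        rw [← insert_inter_distrib, disjoint_iff_inter_eq_empty.1 hd]
        simp
      have d01 : Disjoint A (insert e B) := disjoint_insert_right.2 ⟨hA', hd⟩
      have d10 : Disjoint (insert e A) B := disjoint_insert_left.2 ⟨hB', hd⟩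
      have d11 : ¬ Disjoint (insert e A) (insert e B) := fun hh =>
        disjoint_left.1 hh (mem_insert_self e A) (mem_insert_self e B)
      simp only [hd, d01, d10, d11, and_true, and_false, if_false, add_zero, Set.mem_ofPred_eq]
      by_cases a0 : A ∈ 𝒜 <;> by_cases a1 : insert e A ∈ 𝒜 <;> by_cases b0 : B ∈ ℬ <;>
        by_cases b1 : insert e B ∈ ℬ <;>
        simp [a0, a1, b0, b1] at h3 ⊢
    · simp [hd, disjoint_insert_left, disjoint_insert_right]

open Finset in
/-- The rectangle covering bound for unique disjointness. -/
theorem three_pow_le_card_mul_two_pow {α ι : Type*} [DecidableEq α] [Fintype ι] (U : Finset α)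
    (𝒜 ℬ : ι → Set (Finset α))
    (hone : ∀ c, ∀ A ∈ 𝒜 c, ∀ B ∈ ℬ c, A ⊆ U → B ⊆ U → #(A ∩ B) ≠ 1)
    (hcover : ∀ A ⊆ U, ∀ B ⊆ U, Disjoint A B → ∃ c, A ∈ 𝒜 c ∧ B ∈ ℬ c) :
    3 ^ #U ≤ Fintype.card ι * 2 ^ #U := by
  classical
  calc 3 ^ #U = ∑ A ∈ U.powerset, ∑ B ∈ U.powerset, (if Disjoint A B then 1 else 0) :=
        (sum_disjoint_pairs U).symm
    _ ≤ ∑ A ∈ U.powerset, ∑ B ∈ U.powerset,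
          ∑ c, (if A ∈ 𝒜 c ∧ B ∈ ℬ c ∧ Disjoint A B then 1 else 0) := by
        refine sum_le_sum fun A hA => sum_le_sum fun B hB => ?_
        split_ifs with hd
        · obtain ⟨c, hc⟩ := hcover A (mem_powerset.1 hA) B (mem_powerset.1 hB) hd
          refine le_trans ?_ (single_le_sum (fun _ _ => Nat.zero_le _) (mem_univ c))
          simp [hc, hd]
        · exact Nat.zero_le _
    _ = ∑ c, ∑ A ∈ U.powerset, ∑ B ∈ U.powerset,
          (if A ∈ 𝒜 c ∧ B ∈ ℬ c ∧ Disjoint A B then 1 else 0) := by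
        rw [sum_comm]
        conv_lhs => enter [2, B]; rw [sum_comm]
        rw [sum_comm]
        exact sum_congr rfl fun c _ => sum_comm
    _ ≤ ∑ _c : ι, 2 ^ #U := by
        refine sum_le_sum fun c _ => ?_
        refine (le_of_eq ?_).trans (sum_disjoint_pairs_rectangle_le U (𝒜 c) (ℬ c) (hone c))
        congr!
    _ = Fintype.card ι * 2 ^ #U := by simp

/-! ### Facets of polytopes -/

section Polyhedra

variable {E : Type*} [NormedAddCommGroup E] [NormedSpace ℝ E] {ι : Type*}

/-- A convex set inside a polyhedron has a point at which only those constraints are tight that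
are tight on the whole set. -/
theorem exists_forall_tight [Finite ι] (A : ι → StrongDual ℝ E) (b : ι → ℝ) {C : Set E}
    (hC : Convex ℝ C) (hne : C.Nonempty) (hle : ∀ x ∈ C, ∀ i, A i x ≤ b i) :
    ∃ x₀ ∈ C, ∀ i, A i x₀ = b i → ∀ x ∈ C, A i x = b i := by
  -- Minimize the number of tight constraints: averaging with a point where a constraint is slack
  -- would lower it.
  obtain ⟨x₀, hx₀, hmin⟩ := exists_minimalFor_of_wellFoundedLT (fun x => x ∈ C)
    (fun x => {i | A i x = b i}.ncard) hne
  refine ⟨x₀, hx₀, fun i hi x hx => ?_⟩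
  by_contra hix
  have hmid : (1 / 2 : ℝ) • x₀ + (1 / 2 : ℝ) • x ∈ C :=
    hC hx₀ hx (by norm_num) (by norm_num) (by norm_num)
  have hlt : {i | A i ((1 / 2 : ℝ) • x₀ + (1 / 2 : ℝ) • x) = b i}.ncard <
      {i | A i x₀ = b i}.ncard := by
    refine Set.ncard_lt_ncard (Set.ssubset_iff_exists.2 ⟨fun j hj => ?_, i, hi, fun hj => ?_⟩)
      (Set.toFinite _)
    · have h1 := hle x₀ hx₀ j
      have h2 := hle x hx j
      simp only [map_add, map_smul, smul_eq_mul, Set.mem_ofPred_eq] at hj ⊢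
      linarith
    · simp only [map_add, map_smul, smul_eq_mul, Set.mem_ofPred_eq] at hj hi
      exact hix (by linarith)
  exact absurd (hmin hmid hlt.le) (not_le.2 hlt)

/-- A common positive step that keeps finitely many strict inequalities. -/
theorem exists_pos_forall_add_mul_le [Finite ι] (p : ι → Prop) (u v w : ι → ℝ)
    (h : ∀ i, p i → u i < w i) :
    ∃ ε : ℝ, 0 < ε ∧ ∀ i, p i → u i + ε * v i ≤ w i := by
  have hev : ∀ᶠ ε : ℝ in nhdsWithin 0 (Set.Ioi 0), ∀ i, p i → u i + ε * v i ≤ w i := by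
    rw [Filter.eventually_all]
    intro i
    by_cases hi : p i
    · have hc : Filter.Tendsto (fun ε : ℝ => u i + ε * v i) (nhdsWithin 0 (Set.Ioi 0))
          (nhds (u i + 0 * v i)) :=
        (Continuous.tendsto (by fun_prop) 0).mono_left nhdsWithin_le_nhds
      have := hc.eventually_lt_const (u := w i) (by simpa using h i hi)
      filter_upwards [this] with ε hε _ using hε.le
    · exact Filter.Eventually.of_forall fun ε hp => absurd hp hi
  obtain ⟨ε, hε, hpos⟩ := (hev.and self_mem_nhdsWithin).exists
  exact ⟨ε, hpos, hε⟩

theorem convex_setOf_forall_le (A : ι → StrongDual ℝ E) (b : ι → ℝ) :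
    Convex ℝ {x | ∀ i, A i x ≤ b i} := by
  rw [Set.ofPred_forall]
  exact convex_iInter fun i => convex_halfSpace_le (A i).toLinearMap.isLinear (b i)

/-- A polytope has finitely many facets. -/
theorem IsPolytope.finite_facets {S : Set E} (hS : IsPolytope S) :
    {F : Set E | IsFacet S F}.Finite := by
  obtain ⟨⟨m, A, b, rfl⟩, -⟩ := hS
  set S := {x | ∀ i, A i x ≤ b i} with hSdef
  -- A face is determined by the constraints tight on all of it, and there are finitely many sets of
  -- constraints.
  have key : ∀ F, IsFacet S F →
      F = {x ∈ S | ∀ i ∈ {i | ∀ y ∈ F, A i y = b i}, A i x = b i} := by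
    rintro F ⟨hexp, hne, -⟩
    obtain ⟨l, hl⟩ := hexp hne
    have hFS : F ⊆ S := hexp.subset
    obtain ⟨x₀, hx₀, htight⟩ := exists_forall_tight A b
      (hexp.convex (convex_setOf_forall_le A b)) hne fun x hx => hFS hx
    refine Set.Subset.antisymm (fun x hx => ⟨hFS hx, fun i hi => hi x hx⟩) ?_
    rintro x ⟨hxS, hx⟩
    -- Moving slightly past `x₀`, away from `x`, stays in `S`; since `x₀` maximizes `l`, this forces
    -- `l x₀ ≤ l x`.
    obtain ⟨ε, hε, hstep⟩ := exists_pos_forall_add_mul_le (fun i => A i x₀ ≠ b i)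
      (fun i => A i x₀) (fun i => A i x₀ - A i x) b
      fun i hi => lt_of_le_of_ne (hFS hx₀ i) hi
    have hmem : x₀ + ε • (x₀ - x) ∈ S := by
      intro i
      simp only [map_add, map_smul, map_sub, smul_eq_mul]
      by_cases hi : A i x₀ = b i
      · rw [hi, hx i (htight i hi)]; simp
      · exact hstep i hi
    have hx₀' := hx₀
    rw [hl] at hx₀' ⊢
    refine ⟨hxS, fun y hy => (hx₀'.2 y hy).trans ?_⟩
    have := hx₀'.2 _ hmem
    simp only [map_add, map_smul, map_sub, smul_eq_mul] at this
    nlinarith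
  refine Set.Finite.of_injOn (f := fun F => {i | ∀ y ∈ F, A i y = b i})
    (Set.mapsTo_univ _ _) ?_ Set.finite_univ
  intro F hF G hG hFG
  dsimp only at hFG
  rw [key F hF, key G hG, hFG]

/-- An irredundant constraint of a polyhedron that is not an implicit equality defines a facet. -/
theorem isFacet_of_irredundant [FiniteDimensional ℝ E] [Finite ι] (A : ι → StrongDual ℝ E)
    (b : ι → ℝ) {j : ι} {d₀ d₁ : E} (hd₀ : ∀ i, A i d₀ ≤ b i) (hj₀ : A j d₀ < b j)
    (htight : ∀ i, A i d₀ = b i → ∀ x, (∀ i, A i x ≤ b i) → A i x = b i)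
    (hd₁ : ∀ i, i ≠ j → A i d₁ ≤ b i) (hj₁ : b j < A j d₁) :
    IsFacet {x | ∀ i, A i x ≤ b i} {x | (∀ i, A i x ≤ b i) ∧ A j x = b j} := by
  set S := {x | ∀ i, A i x ≤ b i} with hS
  set G := {x | (∀ i, A i x ≤ b i) ∧ A j x = b j} with hG
  obtain ⟨t, ht0, ht1, ht⟩ : ∃ t : ℝ, 0 < t ∧ t < 1 ∧ (1 - t) * A j d₀ + t * A j d₁ = b j := by
    have hpos : 0 < A j d₁ - A j d₀ := by linarith
    refine ⟨(b j - A j d₀) / (A j d₁ - A j d₀), div_pos (by linarith) hpos,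
      (div_lt_one hpos).2 (by linarith), ?_⟩
    field_simp
    ring
  -- The segment crosses the hyperplane of constraint `j` at `d`, where every other constraint that
  -- is not an implicit equality is strict. So small moves from `d` inside this hyperplane, along
  -- directions of `S`, stay in the face.
  set d := (1 - t) • d₀ + t • d₁ with hd
  have hAd : ∀ i, A i d = (1 - t) * A i d₀ + t * A i d₁ := fun i => by simp [hd]
  have hdj : A j d = b j := by rw [hAd, ht]
  have hdS : d ∈ S := by
    intro i
    by_cases hij : i = j
    · rw [hij, hdj]
    · rw [hAd]
      nlinarith [hd₀ i, hd₁ i hij]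
  have hdlt : ∀ i, i ≠ j → A i d₀ ≠ b i → A i d < b i := by
    intro i hij hi
    have h0 := lt_of_le_of_ne (hd₀ i) hi
    rw [hAd]
    nlinarith [hd₁ i hij]
  have hdG : d ∈ G := ⟨hdS, hdj⟩
  refine ⟨fun _ => ⟨A j, ?_⟩, ⟨d, hdG⟩, ?_⟩
  · ext x
    constructor
    · rintro ⟨hx, hxj⟩
      exact ⟨hx, fun y hy => hxj ▸ hy j⟩
    · rintro ⟨hx, hxj⟩
      exact ⟨hx, le_antisymm (hx j) (hdj ▸ hxj d hdS)⟩
  · have hspan : vectorSpan ℝ G = vectorSpan ℝ S ⊓ LinearMap.ker (A j).toLinearMap := by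
      apply le_antisymm
      · refine le_inf (vectorSpan_mono ℝ fun x hx => hx.1) ?_
        rw [vectorSpan_def, Submodule.span_le]
        rintro _ ⟨x, hx, y, hy, rfl⟩
        simp [hx.2, hy.2]
      · rintro v ⟨hvS, hvj⟩
        replace hvj : A j v = 0 := hvj
        have himp : ∀ i, A i d₀ = b i → A i v = 0 := by
          intro i hi
          have : vectorSpan ℝ S ≤ LinearMap.ker (A i).toLinearMap := by
            rw [vectorSpan_def, Submodule.span_le]
            rintro _ ⟨x, hx, y, hy, rfl⟩
            simp [htight i hi x hx, htight i hi y hy]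
          exact this hvS
        obtain ⟨ε, hε, hstep⟩ := exists_pos_forall_add_mul_le (fun i => i ≠ j ∧ A i d₀ ≠ b i)
          (fun i => A i d) (fun i => A i v) b fun i hi => hdlt i hi.1 hi.2
        have hmem : d + ε • v ∈ G := by
          refine ⟨fun i => ?_, by simp [hdj, hvj]⟩
          simp only [map_add, map_smul, smul_eq_mul]
          by_cases hij : i = j
          · rw [hij, hdj, hvj]; simp
          by_cases hi : A i d₀ = b i
          · rw [himp i hi]; simpa using hdS i
          · exact hstep i ⟨hij, hi⟩
        have hsub := vsub_mem_vectorSpan ℝ hmem hdG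
        simp only [vsub_eq_sub, add_sub_cancel_left] at hsub
        exact (Submodule.smul_mem_iff _ hε.ne').1 hsub
    set W := vectorSpan ℝ S
    let φ : W →ₗ[ℝ] ℝ := (A j).toLinearMap.comp W.subtype
    have hφ : φ ≠ 0 := by
      intro h0
      have h1 : φ ⟨d -ᵥ d₀, vsub_mem_vectorSpan ℝ hdS hd₀⟩ = 0 := by rw [h0]; rfl
      have h2 : A j (d - d₀) = 0 := h1
      rw [map_sub] at h2
      linarith
    have hrank := Module.Dual.finrank_ker_add_one_of_ne_zero hφ
    rw [← hrank, hspan]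
    congr 1
    have hker : LinearMap.ker φ =
        (W ⊓ LinearMap.ker (A j).toLinearMap).comap W.subtype := by
      ext x; simp [φ]
    rw [hker]
    exact (LinearEquiv.finrank_eq (Submodule.comapSubtypeEquivOfLe inf_le_left)).symm

/-- Every point of a polytope outside a nonempty face is separated from the face by a facet. -/
theorem IsPolytope.exists_isFacet [FiniteDimensional ℝ E] {S : Set E} (hS : IsPolytope S)
    (f : E →ₗ[ℝ] ℝ) (c : ℝ) (hf : ∀ x ∈ S, c ≤ f x) (hne : ∃ x ∈ S, f x = c) {z : E}
    (hz : z ∈ S) (hfz : f z ≠ c) :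
    ∃ F, IsFacet S F ∧ z ∉ F ∧ ∀ x ∈ S, f x = c → x ∈ F := by
  classical
  obtain ⟨⟨m, A, b, hSA⟩, -⟩ := hS
  -- In a minimal subsystem describing `S` every constraint is irredundant.
  obtain ⟨J, hJ, hmin⟩ := exists_minimal_of_wellFoundedLT
    (fun J : Finset (Fin m) => S = {x | ∀ i : J, A i x ≤ b i})
    ⟨Finset.univ, by simpa using hSA⟩
  let A' : J → StrongDual ℝ E := fun i => A i
  let b' : J → ℝ := fun i => b i
  replace hJ : S = {x | ∀ i, A' i x ≤ b' i} := hJ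
  have hSle : ∀ x ∈ S, ∀ i, A' i x ≤ b' i := fun x hx => by rwa [hJ] at hx
  have hconv : Convex ℝ S := hJ ▸ convex_setOf_forall_le A' b'
  obtain ⟨d₀, hd₀, htight₀⟩ := exists_forall_tight A' b' hconv ⟨z, hz⟩ hSle
  obtain ⟨x₀, ⟨hx₀S, hx₀f⟩, htight⟩ := exists_forall_tight A' b'
    (C := {x | x ∈ S ∧ f x = c}) (hconv.inter (convex_hyperplane f.isLinear c)) hne
    fun x hx => hSle x hx.1
  -- Otherwise one could move from `x₀` away from `z` within `S`, pushing `f` below its minimum `c`.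
  obtain ⟨j, hj, hjz⟩ : ∃ j, A' j x₀ = b' j ∧ A' j z ≠ b' j := by
    by_contra! hcon
    obtain ⟨ε, hε, hstep⟩ := exists_pos_forall_add_mul_le (fun i => A' i x₀ ≠ b' i)
      (fun i => A' i x₀) (fun i => A' i x₀ - A' i z) b'
      fun i hi => lt_of_le_of_ne (hSle x₀ hx₀S i) hi
    have hmem : x₀ + ε • (x₀ - z) ∈ S := by
      rw [hJ]
      intro i
      simp only [map_add, map_smul, map_sub, smul_eq_mul]
      by_cases hi : A' i x₀ = b' i
      · rw [hi, hcon i hi]; simp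
      · exact hstep i hi
    have h1 := hf _ hmem
    simp only [map_add, map_smul, map_sub, smul_eq_mul, hx₀f] at h1
    have h2 : c < f z := lt_of_le_of_ne (hf z hz) (Ne.symm hfz)
    nlinarith
  obtain ⟨d₁, hd₁, hj₁⟩ : ∃ d₁, (∀ i, i ≠ j → A' i d₁ ≤ b' i) ∧ b' j < A' j d₁ := by
    by_contra! hcon
    have hle := hmin (y := J.erase j) (by
      change S = _
      refine Set.Subset.antisymm (fun x hx i => ?_) fun x hx => ?_
      · exact hSle x hx ⟨i, Finset.mem_of_mem_erase i.2⟩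
      · have hx' : ∀ i : J, i ≠ j → A' i x ≤ b' i := fun i hi =>
          hx ⟨i, Finset.mem_erase.2 ⟨fun h => hi (Subtype.ext h), i.2⟩⟩
        rw [hJ]
        intro i
        by_cases hi : i = j
        · rw [hi]; exact hcon x hx'
        · exact hx' i hi) (Finset.erase_subset _ _)
    exact Finset.notMem_erase j.1 J (hle j.2)
  have hjd₀ : A' j d₀ < b' j :=
    lt_of_le_of_ne (hSle d₀ hd₀ j) fun h => hjz (htight₀ j h z hz)
  have hfacet := isFacet_of_irredundant A' b' (hSle d₀ hd₀) hjd₀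
    (fun i hi x hx => htight₀ i hi x (by rw [hJ]; exact hx)) hd₁ hj₁
  rw [← hJ] at hfacet
  exact ⟨_, hfacet, fun h => hjz h.2, fun x hx hfx => ⟨hSle x hx, htight j hj x ⟨hx, hfx⟩⟩⟩

/-- A polytope is an extended formulation of itself, so its extension complexity is attained. -/
theorem IsPolytope.exists_extendedFormulation {P : Set E} (hP : IsPolytope P) :
    ∃ (r : ℕ) (Q : Set (E × (Fin r → ℝ))),
      IsExtendedFormulation Q P ∧ polytopeSize Q = extensionComplexity P := by
  refine Nat.sInf_mem (s := {k : ℕ | ∃ (r : ℕ) (Q : Set (E × (Fin r → ℝ))),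
    IsExtendedFormulation Q P ∧ polytopeSize Q = k})
    ⟨_, 0, P ×ˢ Set.univ, ⟨⟨?_, ?_⟩, ?_⟩, rfl⟩
  · obtain ⟨⟨m, A, b, rfl⟩, -⟩ := hP
    refine ⟨m, fun i => (A i).comp (ContinuousLinearMap.fst ℝ E (Fin 0 → ℝ)), b, ?_⟩
    ext x
    simp
  · exact hP.2.prod (Set.finite_univ.isBounded)
  · ext x
    simp

end Polyhedra

/-! ### Slacks of QAP3 inequalities at vertices -/

/-- The left-hand side of a QAP3 inequality as a linear map. -/
def qap3LhsLinear {n : ℕ} (P₁ P₂ Q : Finset (Fin n)) (β : ℤ) : QAPSpace n →ₗ[ℝ] ℝ where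
  toFun := qap3Lhs P₁ P₂ Q β
  map_add' Y Z := by
    simp only [qap3Lhs, Pi.add_apply, Finset.sum_add_distrib]
    ring
  map_smul' a Y := by
    simp only [qap3Lhs, Pi.smul_apply, smul_eq_mul, ← Finset.mul_sum, RingHom.id_apply]
    ring

/-- The quadratic terms count pairs of distinct positions of `P` sent into `Q`; with at most one
such position only the diagonal terms survive. -/
theorem qap3Lhs_qapVertex {n : ℕ} (P Q : Finset (Fin n)) (σ : Equiv.Perm (Fin n))
    (h : (P.filter fun i => σ i ∈ Q).card ≤ 1) :
    qap3Lhs P ∅ Q 2 (qapVertex σ) = -((P.filter fun i => σ i ∈ Q).card : ℝ) := by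
  have hdiag : ∑ p ∈ P ×ˢ Q, qapVertex σ p p = ((P.filter fun i => σ i ∈ Q).card : ℝ) := by
    rw [Finset.sum_product, Finset.card_filter]
    push_cast
    refine Finset.sum_congr rfl fun i _ => ?_
    simp [qapVertex, Equiv.Perm.permMatrix, PEquiv.toMatrix_apply]
  have hoff : ∑ p ∈ P ×ˢ Q, ∑ q ∈ P ×ˢ Q with p.1 < q.1, qapVertex σ p q = 0 := by
    refine Finset.sum_eq_zero fun p hp => Finset.sum_eq_zero fun q hq => ?_
    rw [Finset.mem_filter, Finset.mem_product] at hq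
    rw [Finset.mem_product] at hp
    by_contra hne
    have hpq : σ p.1 = p.2 ∧ σ q.1 = q.2 := by
      by_contra hcon
      apply hne
      simp only [qapVertex, Equiv.Perm.permMatrix, PEquiv.toMatrix_apply]
      by_cases h1 : σ p.1 = p.2 <;> by_cases h2 : σ q.1 = q.2 <;> simp_all
    have := Finset.card_le_one.1 h p.1 (by simp [hp, hpq]) q.1 (by simp [hq, hpq])
    exact hq.2.ne this
  simp only [qap3Lhs, hdiag, hoff]
  simp
  norm_num

/-- Two finite sets of the same size are related by a permutation. -/
theorem Finset.exists_perm_forall_mem_iff {α : Type*} [Fintype α] [DecidableEq α]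
    {B Q : Finset α} (h : B.card = Q.card) : ∃ σ : Equiv.Perm α, ∀ i, σ i ∈ Q ↔ i ∈ B := by
  let e : {x // x ∈ B} ≃ {x // x ∈ Q} := Finset.equivOfCardEq h
  refine ⟨e.extendSubtype, fun i => ⟨fun hi => ?_, fun hi => e.extendSubtype_mem i hi⟩⟩
  by_contra hB
  exact e.extendSubtype_not_mem i hB hi

open Finset in
/-- The slack matrix of QAP3 contains the unique disjointness matrix on `m` elements. -/
theorem exists_unique_disjointness_slack {n m : ℕ} (hn : 2 * m + 7 ≤ n) :
    ∃ (U Q : Finset (Fin n)) (P : Finset (Fin n) → Finset (Fin n))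
      (σ : Finset (Fin n) → Equiv.Perm (Fin n)), #U = m ∧
      (∀ A ⊆ U, IsQAP3Param n (P A) ∅ Q 2) ∧
      ∀ A ⊆ U, ∀ B ⊆ U, #{i ∈ P A | σ B i ∈ Q} = #(A ∩ B) := by
  have hcard : ∀ a k : ℕ, a + k ≤ n → ∃ s : Finset (Fin n), #s = k ∧
      ∀ i ∈ s, a ≤ i.1 ∧ i.1 < a + k := by
    intro a k hk
    refine ⟨univ.image fun i : Fin k => (⟨a + i, by omega⟩ : Fin n), ?_, fun i hi => ?_⟩
    · rw [card_image_of_injective _ fun i j hij => ?_, card_univ, Fintype.card_fin]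
      simpa [Fin.ext_iff] using hij
    · obtain ⟨j, -, rfl⟩ := mem_image.1 hi
      simp
  obtain ⟨U, hU, hUm⟩ := hcard 0 m (by omega)
  -- `W` serves both as Q and as a reservoir padding each B to size |Q|. The two elements of `D`
  -- ensure |P₁| ≥ 2 and are never sent into Q. Condition (v) becomes |A| ≤ n - m - 7, whence `2 * m
  -- + 7 ≤ n`.
  obtain ⟨W, hW, hWm⟩ := hcard m (m + 3) (by omega)
  obtain ⟨D, hD, hDm⟩ := hcard (m + (m + 3)) 2 (by omega)
  have hUD : ∀ i ∈ U, i ∉ D := fun i h1 h2 => by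
    have := hUm i h1; have := hDm i h2; omega
  have hUW : ∀ i ∈ U, i ∉ W := fun i h1 h2 => by
    have := hUm i h1; have := hWm i h2; omega
  have hWD : ∀ i ∈ W, i ∉ D := fun i h1 h2 => by
    have := hWm i h1; have := hDm i h2; omega
  have hσ : ∀ B : Finset (Fin n), ∃ σ : Equiv.Perm (Fin n), B ⊆ U →
      ∃ T ⊆ W, ∀ i, σ i ∈ W ↔ i ∈ B ∪ T := by
    intro B
    by_cases hB : B ⊆ U
    · have hBc := card_le_card hB
      obtain ⟨T, hTW, hT⟩ := exists_subset_card_eq (s := W) (n := m + 3 - #B) (by omega)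
      have hdisj : Disjoint B T := disjoint_left.2 fun i h1 h2 => hUW i (hB h1) (hTW h2)
      obtain ⟨σ, hσ⟩ := exists_perm_forall_mem_iff (B := B ∪ T) (Q := W) (by
        rw [card_union_of_disjoint hdisj]; omega)
      exact ⟨σ, fun _ => ⟨T, hTW, hσ⟩⟩
    · exact ⟨1, fun h => absurd h hB⟩
  choose σ hσ using hσ
  refine ⟨U, W, fun A => A ∪ D, σ, hU, fun A hA => ?_, fun A hA B hB => ?_⟩
  · have hAc := card_le_card hA
    have hdisj : Disjoint A D := disjoint_left.2 fun i h1 h2 => hUD i (hA h1) h2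
    have hAD : #(A ∪ D) = #A + 2 := by rw [card_union_of_disjoint hdisj, hD]
    constructor
    · simp
    · omega
    · omega
    · rw [hAD, card_empty]; push_cast; omega
    · rw [hAD]; push_cast; omega
    · simp
    · rw [hAD, card_empty, hW, abs_le]; push_cast; constructor <;> omega
    · simp
    · simp
  · obtain ⟨T, hTW, hT⟩ := hσ B hB
    congr 1
    ext i
    simp only [mem_filter, hT, mem_union, mem_inter]
    constructor
    · rintro ⟨hA' | hD', hB' | hT'⟩
      · exact ⟨hA', hB'⟩
      · exact absurd (hTW hT') (hUW i (hA hA'))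
      · exact absurd hD' (hUD i (hB hB'))
      · exact absurd hD' (hWD i (hTW hT'))
    · rintro ⟨hA', hB'⟩
      exact ⟨Or.inl hA', Or.inl hB'⟩

/-! ### The lower bound -/

open Finset in
theorem three_pow_le_extensionComplexity {n m : ℕ} (hn : 2 * m + 7 ≤ n) {R : Set (QAPSpace n)}
    (hR : IsBoundedQAPRelaxation R) (hvalid : QAP3Valid R) :
    3 ^ m ≤ (extensionComplexity R + 1) * 2 ^ m := by
  obtain ⟨r, S, ⟨hS, hproj⟩, hsize⟩ := hR.1.exists_extendedFormulation
  obtain ⟨U, Q, P, σ, hU, hparam, hcount⟩ := exists_unique_disjointness_slack hn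
  have hvert : ∀ B, ∃ y, (qapVertex (σ B), y) ∈ S := by
    intro B
    have : qapVertex (σ B) ∈ R := hR.2 (subset_convexHull ℝ _ ⟨_, rfl⟩)
    rwa [hproj] at this
  choose y hy using hvert
  let f : Finset (Fin n) → QAPSpace n × (Fin r → ℝ) →ₗ[ℝ] ℝ := fun A =>
    (qap3LhsLinear (P A) ∅ Q 2).comp (LinearMap.fst ℝ _ _)
  have hf : ∀ A ⊆ U, ∀ x ∈ S, -1 ≤ f A x := by
    intro A hA x hx
    have hxR : x.1 ∈ R := by rw [hproj]; exact ⟨x.2, hx⟩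
    have := hvalid _ _ _ _ (hparam A hA) _ hxR
    have h2 : (((2 : ℤ) : ℝ) - ((2 : ℤ) : ℝ) ^ 2) / 2 = -1 := by norm_num
    rwa [h2] at this
  have hfv : ∀ A ⊆ U, ∀ B ⊆ U, #(A ∩ B) ≤ 1 →
      f A (qapVertex (σ B), y B) = -(#(A ∩ B) : ℝ) := by
    intro A hA B hB h
    rw [← hcount A hA B hB] at h ⊢
    exact qap3Lhs_qapVertex _ _ _ h
  -- Finiteness matters: `ncard` would be 0 on an infinite set.
  have hfin := hS.finite_facets
  have : Fintype {F | IsFacet S F} := hfin.fintype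
  have hcardF : Fintype.card (Option {F | IsFacet S F}) = extensionComplexity R + 1 := by
    rw [Fintype.card_option, ← hsize, polytopeSize, Set.ncard_eq_toFinset_card', Set.toFinset_card]
  rw [← hcardF, ← hU]
  -- The index `none` handles inequalities that are nowhere tight on `S`, which spares a proof of
  -- tightness at the cost of the `+ 1`.
  refine three_pow_le_card_mul_two_pow U
    (fun c => c.elim {A | ∀ x ∈ S, f A x ≠ -1} fun F => {A | ∀ x ∈ S, f A x = -1 → x ∈ F.1})
    (fun c => c.elim Set.univ fun F => {B | (qapVertex (σ B), y B) ∉ F.1}) ?_ ?_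
  · rintro c A hA B hB hAU hBU hone
    have hval : f A (qapVertex (σ B), y B) = -1 := by rw [hfv A hAU B hBU hone.le, hone]; simp
    cases c with
    | none => exact hA _ (hy B) hval
    | some F => exact hB (hA _ (hy B) hval)
  · intro A hA B hB hdisj
    by_cases hne : ∃ x ∈ S, f A x = -1
    · have hcard0 : #(A ∩ B) = 0 := by rw [disjoint_iff_inter_eq_empty.1 hdisj, card_empty]
      obtain ⟨F, hF, hzF, hsub⟩ := hS.exists_isFacet (f A) (-1) (hf A hA) hne (hy B) (by
        rw [hfv A hA B hB (by omega), hcard0]; norm_num)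
      exact ⟨some ⟨F, hF⟩, hsub, hzF⟩
    · exact ⟨none, fun x hx h => hne ⟨x, hx, h⟩, trivial⟩

theorem mainTheorem4 :
    ∃ c : ℝ, 0 < c ∧ ∃ N : ℕ, ∀ n : ℕ, N ≤ n → ∀ R : Set (QAPSpace n),
      IsBoundedQAPRelaxation R → QAP3Valid R →
        (2 : ℝ) ^ (c * (n : ℝ)) ≤ (extensionComplexity R : ℝ) := by
  -- Since (3/2)^m ≥ 2^(m/2) and m/2 ≥ n/4 - 2, the exponent is at least n/8 + 1 once n ≥ 24; the
  -- spare factor 2 absorbs the extra rectangle.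
  refine ⟨1 / 8, by norm_num, 24, fun n hn R hR hvalid => ?_⟩
  obtain ⟨m, hm, hm'⟩ : ∃ m, 2 * m + 7 ≤ n ∧ n ≤ 2 * m + 8 :=
    ⟨(n - 7) / 2, by omega, by omega⟩
  have hxc : (3 : ℝ) ^ m ≤ (extensionComplexity R + 1) * 2 ^ m := by
    exact_mod_cast three_pow_le_extensionComplexity hm hR hvalid
  have hxc' : (3 / 2 : ℝ) ^ m ≤ extensionComplexity R + 1 := by
    rw [div_pow]
    exact (div_le_iff₀ (by positivity)).2 hxc
  have hn' : (24 : ℝ) ≤ n := by exact_mod_cast hn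
  have hnm : (n : ℝ) ≤ 2 * m + 8 := by exact_mod_cast hm'
  have hbase : (2 : ℝ) ^ (1 / 2 : ℝ) ≤ 3 / 2 := by
    rw [← Real.sqrt_eq_rpow, Real.sqrt_le_left (by norm_num)]
    norm_num
  have hpow : (2 : ℝ) ^ (1 / 8 * (n : ℝ) + 1) ≤ (3 / 2 : ℝ) ^ m := by
    calc (2 : ℝ) ^ (1 / 8 * (n : ℝ) + 1) ≤ 2 ^ (1 / 2 * (m : ℝ)) :=
          Real.rpow_le_rpow_of_exponent_le (by norm_num) (by linarith)
      _ = ((2 : ℝ) ^ (1 / 2 : ℝ)) ^ m := by rw [Real.rpow_mul (by norm_num), Real.rpow_natCast]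
      _ ≤ (3 / 2 : ℝ) ^ m := pow_le_pow_left₀ (by positivity) hbase m
  rw [Real.rpow_add (by norm_num), Real.rpow_one] at hpow
  have hone : (1 : ℝ) ≤ 2 ^ (1 / 8 * (n : ℝ)) := Real.one_le_rpow (by norm_num) (by positivity)
  linarith
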